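/- Let $d,n\ge 1$ be integers and let $V:\mathbb{R}^d\to\mathbb{R}$ be such that $e^{-V}$ is a probability density on $\mathbb{R}^d$. For $\theta\in\mathbb{R}^d$ let $X_1,\dots,X_n$ be i.i.d. with distribution $P_\theta(dx)=e^{-V(x-\theta)}dx$, and denote by $\mathbb{P}_\theta$ the corresponding probability. Assume, for some constants $m,M,L>0$: (i) $V$ is strictly convex and twice continuously differentiable, $\|V''(x)\|\le M$ and $\|V''(x)-V''(y)\|\le L\|x-y\|$ for all $x,y\in\mathbb{R}^d$; (ii) the Fisher information matrix $\mathcal{I}=\int_{\mathbb{R}^d}V'(x)\otimes V'(x)\,e^{-V(x)}dx$ satisfies $\mathcal{I}\succeq mI_d$. Here $\|\cdot\|$ is the Euclidean norm of vectors and the operator norm of multilinear forms. For $s=l+\rho>0$ with an integer $l\ge 0$ and $\rho\in(0,1]$, and for an $l$ times Fréchet differentiable function $f:\mathbb{R}^d\to\mathbb{R}$, put $$\|f\|_{C^s}=\max_{0\le j\le l}\ \sup_{x}\|f^{(j)}(x)\|\ \vee\ \sup_{x\ne y}\frac{\|f^{(l)}(x)-f^{(l)}(y)\|}{\|x-y\|^{\rho}}.$$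 Then for every $s>0$ there is a constant $c>0$, depending only on $m$, $M$ and $s$ (in particular not on $n$, $d$, $L$ or $V$), such that $$\sup_{\|f\|_{C^s}\le 1}\ \inf_{\hat T_n}\ \sup_{\|\theta\|\le 1}\|\hat T_n-f(\theta)\|_{L_2(\mathbb{P}_\theta)}\ \ge\ c\,\Bigl[\Bigl(\frac{1}{\sqrt n}\vee\Bigl(\sqrt{\frac dn}\Bigr)^{s}\Bigr)\wedge 1\Bigr],$$ where the infimum is taken over all estimators $\hat T_n=\hat T_n(X_1,\dots,X_n)$ (measurable real functions of the observations). -/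

import Mathlib

open MeasureTheory
open scoped ENNReal

noncomputable section

namespace LogConcave

/-- The Euclidean space `ℝ^d`. -/
abbrev Euc (d : ℕ) : Type := EuclideanSpace ℝ (Fin d)

/-- The distribution `P_θ(dx) = e^{-V(x-θ)} dx` of the location family generated by `e^{-V}`. -/
def locationMeasure {d : ℕ} (V : Euc d → ℝ) (θ : Euc d) : Measure (Euc d) :=
  volume.withDensity (fun x => ENNReal.ofReal (Real.exp (-V (x - θ))))

/-- The law of i.i.d. observations `X_1, …, X_n` with common distribution `P_θ`. -/
def sampleMeasure {d : ℕ} (V : Euc d → ℝ) (n : ℕ) (θ : Euc d) : Measure (Fin n → Euc d) :=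
  Measure.pi (fun _ : Fin n => locationMeasure V θ)

/-- The Fisher information matrix `∫ V'(x) ⊗ V'(x) e^{-V(x)} dx`. -/
def fisherInformation {d : ℕ} (V : Euc d → ℝ) : Matrix (Fin d) (Fin d) ℝ :=
  Matrix.of fun i j => ∫ x : Euc d, gradient V x i * gradient V x j * Real.exp (-V x)

/-- The assumption on `V`, with constants `m`, `M`, `L`: `e^{-V}` is a probability density,
`V` is strictly convex and twice continuously differentiable, `‖V''‖_∞ ≤ M`, `‖V''‖_Lip ≤ L`,
and the Fisher information is at least `m I_d` in the Loewner order. -/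
structure MainAssumption {d : ℕ} (V : Euc d → ℝ) (m M L : ℝ) : Prop where
  isDensity : ∫⁻ x : Euc d, ENNReal.ofReal (Real.exp (-V x)) = 1
  strictConvex : StrictConvexOn ℝ Set.univ V
  contDiff : ContDiff ℝ 2 V
  hessian_bound : ∀ x, ‖iteratedFDeriv ℝ 2 V x‖ ≤ M
  hessian_lipschitz : ∀ x y, ‖iteratedFDeriv ℝ 2 V x - iteratedFDeriv ℝ 2 V y‖ ≤ L * ‖x - y‖
  fisher_bound : (fisherInformation V - m • (1 : Matrix (Fin d) (Fin d) ℝ)).PosSemidef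

/-- For `s > 0`, the integer `l ≥ 0` with `s = l + ρ`, `ρ ∈ (0, 1]`. -/
def holderOrder (s : ℝ) : ℕ := ⌈s⌉₊ - 1

open Classical in
/-- The Hölder norm `‖f‖_{C^s}` for `s = l + ρ`, `ρ ∈ (0, 1]`: the maximum of the suprema of
`‖f^{(j)}‖` for `0 ≤ j ≤ l` and of the `ρ`-Hölder seminorm of `f^{(l)}`. It is infinite when `f` is
not `C^l`; a function that is `l` times differentiable with a `ρ`-Hölder `l`-th derivative
is `C^l`. -/
def holderNorm {d : ℕ} (s : ℝ) (f : Euc d → ℝ) : ℝ≥0∞ :=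
  if ContDiff ℝ (holderOrder s) f then
    max (⨆ j ∈ Finset.range (holderOrder s + 1), ⨆ x : Euc d, ‖iteratedFDeriv ℝ j f x‖ₑ)
      (⨆ (x : Euc d) (y : Euc d) (_ : x ≠ y),
        ‖iteratedFDeriv ℝ (holderOrder s) f x - iteratedFDeriv ℝ (holderOrder s) f y‖ₑ /
          ‖x - y‖ₑ ^ (s - holderOrder s))
  else ∞

/-- The `L_2(P_θ)`-risk `‖T(X_1, …, X_n) - f(θ)‖_{L_2}` of the estimator `T` of `f(θ)`. -/
def risk {d : ℕ} (V : Euc d → ℝ) (n : ℕ) (f : Euc d → ℝ) (T : (Fin n → Euc d) → ℝ)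
    (θ : Euc d) : ℝ≥0∞ :=
  eLpNorm (fun X => T X - f θ) 2 (sampleMeasure V n θ)

/-- `sup_{‖f‖_{C^s} ≤ 1} inf_T sup_{‖θ‖ ≤ 1} ‖T - f(θ)‖_{L_2(P_θ)}`, the infimum being over all
estimators (measurable functions of the sample). -/
def minimaxRisk {d : ℕ} (V : Euc d → ℝ) (n : ℕ) (s : ℝ) : ℝ≥0∞ :=
  ⨆ (f : Euc d → ℝ) (_ : holderNorm s f ≤ 1),
    ⨅ (T : (Fin n → Euc d) → ℝ) (_ : Measurable T),
      ⨆ (θ : Euc d) (_ : ‖θ‖ ≤ 1), risk V n f T θ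

end LogConcave

end

/-!
The lower bound rests on a second moment estimate for likelihood ratios. Since `‖V''‖ ≤ M`,
the second difference `V x + V (x - 2 θ) - 2 V (x - θ)` is at most `2 M ‖θ‖²`, so the square of the
density of `P_θ` relative to `P_0` is at most `exp (2 M ‖θ‖²)` times the density of `P_{2θ}`. For the
law of a sample of size `n` the second moment is therefore at most `exp (2 M n ‖θ‖²)`
(`lintegral_likelihoodRatio_sq_le`).

Given `N` parameters `θ i` whose likelihood ratios `g i` have second moments at most `3 N / 4`, there
are signs `σ i` with `∫ (∑ i, σ i * g i)² dP_0 ≤ ∑ i, ∫ (g i)² dP_0 ≤ 3 N² / 4`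
(`exists_signs_lintegral_sq_le`). Hence the mixtures over the positive and over the negative signs
cannot be told apart reliably, and every estimator of the numbers `c * σ i` has error at least
`c / 8` under some `θ i` (`exists_signs_forall_estimator`). It remains to exhibit, for every choice
of signs, a function `f` in the Hölder ball with `f (θ i) = c * σ i` (`le_minimaxRisk`).

* For the rate `1 / √n`, take `N = 2` and `θ = ± t e` with `‖e‖ = 1` and `t` of order `1 / √n`; `f` is
  a constant or `± sin ⟪e, x⟫ / 2`.
* For the rate `ε ^ s` with `ε = √(d / n) ∧ 1`, take `N = 2 ^ d` points in a ball of radius of order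
  `ε`, with mutual distances of the same order; they exist by a volume argument. The second moments
  are at most `(3 / 2) ^ d ≤ 3 N / 4`. The function `f` is a signed sum of bumps of width `δ` of order
  `ε` and height of order `δ ^ s` with disjoint supports. As the bump is a function of the norm, its
  derivatives are bounded independently of the dimension (`exists_norm_iteratedFDeriv_bump_le`),
  so the constant does not depend on `d`.
-/

noncomputable section

namespace LogConcave

/-! ### Product measures -/

theorem lintegral_pi_prod {ι α : Type*} [Fintype ι] [MeasurableSpace α] (μ : ι → Measure α)
    [∀ i, IsProbabilityMeasure (μ i)] {f : ι → α → ℝ≥0∞} (hf : ∀ i, Measurable (f i)) :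
    ∫⁻ x, ∏ i, f i (x i) ∂Measure.pi μ = ∏ i, ∫⁻ a, f i a ∂μ i := by
  have hind : ProbabilityTheory.iIndepFun (fun i (x : ι → α) => f i (x i)) (Measure.pi μ) :=
    ProbabilityTheory.iIndepFun_pi (fun i => (hf i).aemeasurable)
  have h := ProbabilityTheory.lintegral_prod_eq_prod_lintegral_of_indepFun Finset.univ
    (fun i (x : ι → α) => f i (x i)) hind
    (fun i => (hf i).comp (measurable_pi_apply i))
  rw [h]
  refine Finset.prod_congr rfl fun i _ => ?_
  exact (measurePreserving_eval μ i).lintegral_comp (hf i)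

theorem pi_withDensity {ι α : Type*} [Fintype ι] [MeasurableSpace α] (μ : ι → Measure α)
    [∀ i, IsProbabilityMeasure (μ i)] {f : ι → α → ℝ≥0∞} (hf : ∀ i, Measurable (f i))
    [∀ i, IsProbabilityMeasure ((μ i).withDensity (f i))] :
    Measure.pi (fun i => (μ i).withDensity (f i)) =
      (Measure.pi μ).withDensity (fun x => ∏ i, f i (x i)) := by
  refine Measure.pi_eq fun s hs => ?_
  rw [withDensity_apply _ (MeasurableSet.univ_pi hs),
    ← lintegral_indicator (MeasurableSet.univ_pi hs)]
  have : ∀ x : ι → α, (Set.univ.pi s).indicator (fun x => ∏ i, f i (x i)) x =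
      ∏ i, (s i).indicator (f i) (x i) := by
    intro x
    by_cases hx : x ∈ Set.univ.pi s
    · rw [Set.indicator_of_mem hx]
      refine Finset.prod_congr rfl fun i _ => ?_
      rw [Set.indicator_of_mem (hx i (Set.mem_univ i))]
    · rw [Set.indicator_of_notMem hx]
      simp only [Set.mem_univ_pi, not_forall] at hx
      obtain ⟨i, hi⟩ := hx
      exact (Finset.prod_eq_zero (Finset.mem_univ i) (Set.indicator_of_notMem hi _)).symm
  simp_rw [this]
  rw [lintegral_pi_prod μ (fun i => (hf i).indicator (hs i))]
  refine Finset.prod_congr rfl fun i _ => ?_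
  rw [withDensity_apply _ (hs i), lintegral_indicator (hs i)]

/-! ### A random-sign lower bound for estimators -/

/-- Signs can be chosen one after the other so that the cross terms do not contribute: by the
parallelogram identity, one of the two signs of a new summand is good enough. -/
theorem exists_signs_lintegral_sq_le {ι Ω : Type*} [MeasurableSpace Ω] (ν : Measure Ω)
    {g : ι → Ω → ℝ} (hg : ∀ i, Measurable (g i)) (t : Finset ι) :
    ∃ σ : ι → ℝ, (∀ i, σ i = 1 ∨ σ i = -1) ∧
      ∫⁻ ω, ENNReal.ofReal ((∑ i ∈ t, σ i * g i ω) ^ 2) ∂ν ≤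
        ∑ i ∈ t, ∫⁻ ω, ENNReal.ofReal (g i ω ^ 2) ∂ν := by
  classical
  induction t using Finset.induction_on with
  | empty => exact ⟨fun _ => 1, by simp, by simp⟩
  | insert a t ha ih =>
    obtain ⟨σ, hσ, h⟩ := ih
    set S : Ω → ℝ := fun ω => ∑ i ∈ t, σ i * g i ω
    have hS : Measurable S := by fun_prop
    have key : ∀ ε : ℝ, ∀ ω, ∑ i ∈ insert a t, Function.update σ a ε i * g i ω
        = S ω + ε * g a ω := by
      intro ε ω
      rw [Finset.sum_insert ha, Function.update_self, add_comm]
      congr 1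
      refine Finset.sum_congr rfl fun i hi => ?_
      rw [Function.update_of_ne (by rintro rfl; exact ha hi)]
    have hsign : ∀ ε : ℝ, (ε = 1 ∨ ε = -1) → ∀ i,
        Function.update σ a ε i = 1 ∨ Function.update σ a ε i = -1 := by
      intro ε hε i
      by_cases hi : i = a
      · subst hi; simpa using hε
      · simpa [Function.update_of_ne hi] using hσ i
    have hpar : ∫⁻ ω, ENNReal.ofReal ((S ω + 1 * g a ω) ^ 2) ∂ν +
        ∫⁻ ω, ENNReal.ofReal ((S ω + (-1) * g a ω) ^ 2) ∂ν =
        (∫⁻ ω, ENNReal.ofReal (g a ω ^ 2) ∂ν + ∫⁻ ω, ENNReal.ofReal (S ω ^ 2) ∂ν) +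
        (∫⁻ ω, ENNReal.ofReal (g a ω ^ 2) ∂ν + ∫⁻ ω, ENNReal.ofReal (S ω ^ 2) ∂ν) := by
      have hga := hg a
      rw [← lintegral_add_left (by fun_prop), ← lintegral_add_left (by fun_prop),
        ← lintegral_add_left (by fun_prop)]
      refine lintegral_congr fun ω => ?_
      rw [← ENNReal.ofReal_add (by positivity) (by positivity),
        ← ENNReal.ofReal_add (by positivity) (by positivity),
        ← ENNReal.ofReal_add (by positivity) (by positivity)]
      congr 1
      ring
    have hle : ∫⁻ ω, ENNReal.ofReal (g a ω ^ 2) ∂ν + ∫⁻ ω, ENNReal.ofReal (S ω ^ 2) ∂ν ≤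
        ∑ i ∈ insert a t, ∫⁻ ω, ENNReal.ofReal (g i ω ^ 2) ∂ν := by
      rw [Finset.sum_insert ha]
      gcongr
    rcases le_or_gt (∫⁻ ω, ENNReal.ofReal ((S ω + 1 * g a ω) ^ 2) ∂ν)
      (∫⁻ ω, ENNReal.ofReal (g a ω ^ 2) ∂ν + ∫⁻ ω, ENNReal.ofReal (S ω ^ 2) ∂ν) with h1 | h1
    · refine ⟨Function.update σ a 1, hsign 1 (Or.inl rfl), ?_⟩
      simp_rw [key]
      exact h1.trans hle
    · refine ⟨Function.update σ a (-1), hsign (-1) (Or.inr rfl), ?_⟩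
      simp_rw [key]
      refine le_trans ?_ hle
      by_contra! h2
      exact absurd hpar (ENNReal.add_lt_add h1 h2).ne'

/-- Estimating `c σ i` under weights `g i` costs at least the total weight, up to the imbalance
`∑ i, σ i * g i` between the two signs. -/
theorem sum_mul_le_sum_mul_abs_sub_add {ι : Type*} (t : Finset ι) {g σ : ι → ℝ}
    (hg : ∀ i, 0 ≤ g i) (hσ : ∀ i, σ i = 1 ∨ σ i = -1) {c : ℝ} (hc : 0 ≤ c) (y : ℝ) :
    ∑ i ∈ t, g i * c ≤ ∑ i ∈ t, g i * |y - c * σ i| + c * |∑ i ∈ t, σ i * g i| := by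
  -- clip `y` to `[-c, c]`
  set τ : ℝ := max (-c) (min c y)
  have hτ : |τ| ≤ c := abs_le.2 ⟨le_max_left _ _, max_le (by linarith) (min_le_left _ _)⟩
  have h1 : ∀ i, c - σ i * τ ≤ |y - c * σ i| := by
    intro i
    rcases hσ i with h | h <;> rw [h]
    · rcases le_total c y with h' | h'
      · have : τ = c := by simp [τ, h', hc]
        rw [this]; simp
      · have : y ≤ τ := by simp [τ, h']
        have := neg_abs_le (y - c * 1); linarith
    · rcases le_total y (-c) with h' | h'
      · have : τ = -c := by simp [τ]; right; linarith
        rw [this]; simp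
      · have : τ ≤ y := by simp [τ, h']
        have := le_abs_self (y - c * -1); linarith
  have h2 : ∑ i ∈ t, g i * (c - σ i * τ) ≤ ∑ i ∈ t, g i * |y - c * σ i| :=
    Finset.sum_le_sum fun i _ => mul_le_mul_of_nonneg_left (h1 i) (hg i)
  have h3 : ∑ i ∈ t, g i * (c - σ i * τ) = ∑ i ∈ t, g i * c - τ * ∑ i ∈ t, σ i * g i := by
    rw [Finset.mul_sum, ← Finset.sum_sub_distrib]
    exact Finset.sum_congr rfl fun i _ => by ring
  have h4 : τ * ∑ i ∈ t, σ i * g i ≤ c * |∑ i ∈ t, σ i * g i| :=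
    (le_abs_self _).trans (by rw [abs_mul]; gcongr)
  linarith

/-- If the `N` densities `g i` have second moments at most `3 N / 4`, then for suitable signs the
mixtures of the densities of either sign are so close that no estimator guesses the sign well
under every `g i`. -/
theorem exists_signs_forall_estimator {ι Ω : Type*} [Fintype ι] [Nonempty ι] [MeasurableSpace Ω]
    (Q : Measure Ω) [IsProbabilityMeasure Q] {g : ι → Ω → ℝ} (hg : ∀ i, Measurable (g i))
    (hg0 : ∀ i ω, 0 ≤ g i ω) (hg1 : ∀ i, ∫⁻ ω, ENNReal.ofReal (g i ω) ∂Q = 1)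
    (hg2 : ∀ i, ∫⁻ ω, ENNReal.ofReal (g i ω ^ 2) ∂Q ≤
      ENNReal.ofReal (3 / 4 * Fintype.card ι)) :
    ∃ σ : ι → ℝ, (∀ i, σ i = 1 ∨ σ i = -1) ∧ ∀ T : Ω → ℝ, Measurable T → ∀ c : ℝ, 0 < c →
      ∃ i, ENNReal.ofReal (c / 8) ≤
        ∫⁻ ω, ‖T ω - c * σ i‖ₑ ∂Q.withDensity (fun ω => ENNReal.ofReal (g i ω)) := by
  obtain ⟨σ, hσ, h⟩ := exists_signs_lintegral_sq_le Q hg Finset.univ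
  refine ⟨σ, hσ, fun T hT c hc => ?_⟩
  set N : ℝ := (Fintype.card ι : ℝ) with hN
  have hN0 : 0 < N := by simp [hN, Fintype.card_pos]
  by_contra! hcon
  set S : Ω → ℝ := fun ω => ∑ i, σ i * g i ω
  have hS : Measurable S := by fun_prop
  have hS2 : ∫⁻ ω, ENNReal.ofReal (S ω ^ 2) ∂Q ≤ ENNReal.ofReal (3 / 4 * N ^ 2) := by
    refine h.trans ((Finset.sum_le_sum fun i _ => hg2 i).trans ?_)
    rw [Finset.sum_const, Finset.card_univ, nsmul_eq_mul, ← ENNReal.ofReal_natCast,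
      ← ENNReal.ofReal_mul (by positivity)]
    exact ENNReal.ofReal_le_ofReal (by rw [← hN]; nlinarith)
  have hdens : ∀ i, ∫⁻ ω, ‖T ω - c * σ i‖ₑ ∂Q.withDensity (fun ω => ENNReal.ofReal (g i ω)) =
      ∫⁻ ω, ENNReal.ofReal (g i ω * |T ω - c * σ i|) ∂Q := by
    intro i
    have := hg i
    rw [lintegral_withDensity_eq_lintegral_mul _ (by fun_prop) (by fun_prop)]
    refine lintegral_congr fun ω => ?_
    rw [Pi.mul_apply, ENNReal.ofReal_mul (hg0 i ω), Real.enorm_eq_ofReal_abs]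
  have hpt : ∀ ω, ∑ i, ENNReal.ofReal (g i ω * c) ≤
      ∑ i, ENNReal.ofReal (g i ω * |T ω - c * σ i|) +
        (ENNReal.ofReal (c / (2 * N)) * ENNReal.ofReal (S ω ^ 2) +
          ENNReal.ofReal (c * N / 2)) := by
    intro ω
    have hA := sum_mul_le_sum_mul_abs_sub_add Finset.univ (fun i => hg0 i ω) hσ hc.le (T ω)
    -- `|S| ≤ (S² / N + N) / 2`
    have hB : c * |S ω| ≤ c / (2 * N) * S ω ^ 2 + c * N / 2 := by
      have h1 : 0 ≤ c / (2 * N) * (|S ω| - N) ^ 2 := by positivity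
      have h2 : c / (2 * N) * (|S ω| - N) ^ 2 =
          c / (2 * N) * S ω ^ 2 + c * N / 2 - c * |S ω| := by
        rw [← sq_abs (S ω)]; field_simp; ring
      linarith
    have hnn : ∀ i ∈ Finset.univ, 0 ≤ g i ω * |T ω - c * σ i| :=
      fun i _ => mul_nonneg (hg0 i ω) (abs_nonneg _)
    rw [← ENNReal.ofReal_sum_of_nonneg (fun i _ => mul_nonneg (hg0 i ω) hc.le),
      ← ENNReal.ofReal_sum_of_nonneg hnn, ← ENNReal.ofReal_mul (by positivity),
      ← ENNReal.ofReal_add (by positivity) (by positivity),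
      ← ENNReal.ofReal_add (Finset.sum_nonneg hnn) (by positivity)]
    exact ENNReal.ofReal_le_ofReal (by linarith)
  have hint := lintegral_mono (μ := Q) hpt
  have hLHS : ∫⁻ ω, ∑ i, ENNReal.ofReal (g i ω * c) ∂Q = ENNReal.ofReal (N * c) := by
    rw [lintegral_finsetSum _ (fun i _ => by have := hg i; fun_prop)]
    have : ∀ i, ∫⁻ ω, ENNReal.ofReal (g i ω * c) ∂Q = ENNReal.ofReal c := by
      intro i
      have := hg i
      simp_rw [fun ω => ENNReal.ofReal_mul (q := c) (hg0 i ω)]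
      rw [lintegral_mul_const _ (by fun_prop), hg1, one_mul]
    simp [this, hN, ENNReal.ofReal_mul]
  have hRHS : ∫⁻ ω, (∑ i, ENNReal.ofReal (g i ω * |T ω - c * σ i|) +
        (ENNReal.ofReal (c / (2 * N)) * ENNReal.ofReal (S ω ^ 2) +
          ENNReal.ofReal (c * N / 2))) ∂Q < ENNReal.ofReal (N * c) := by
    rw [lintegral_add_left (Finset.measurable_sum _ fun i _ => by have := hg i; fun_prop),
      lintegral_finsetSum _ (fun i _ => by have := hg i; fun_prop),
      lintegral_add_left (by fun_prop), lintegral_const_mul _ (by fun_prop), lintegral_const,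
      measure_univ, mul_one]
    have h1 : ∑ i, ∫⁻ ω, ENNReal.ofReal (g i ω * |T ω - c * σ i|) ∂Q <
        ENNReal.ofReal (N * (c / 8)) := by
      have : ∑ i, ∫⁻ ω, ENNReal.ofReal (g i ω * |T ω - c * σ i|) ∂Q <
          ∑ _i : ι, ENNReal.ofReal (c / 8) :=
        ENNReal.sum_lt_sum_of_nonempty Finset.univ_nonempty
          (fun i _ => by rw [← hdens]; exact hcon i)
      simpa [hN, ENNReal.ofReal_mul] using this
    have h2 : ENNReal.ofReal (c / (2 * N)) * ∫⁻ ω, ENNReal.ofReal (S ω ^ 2) ∂Q +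
        ENNReal.ofReal (c * N / 2) ≤ ENNReal.ofReal (N * c * (7 / 8)) := by
      have h3 : ENNReal.ofReal (c / (2 * N)) * ∫⁻ ω, ENNReal.ofReal (S ω ^ 2) ∂Q +
        ENNReal.ofReal (c * N / 2) ≤ ENNReal.ofReal (c / (2 * N)) *
          ENNReal.ofReal (3 / 4 * N ^ 2) + ENNReal.ofReal (c * N / 2) := by gcongr
      refine h3.trans ?_
      rw [← ENNReal.ofReal_mul (by positivity), ← ENNReal.ofReal_add (by positivity)
        (by positivity)]
      refine ENNReal.ofReal_le_ofReal (le_of_eq ?_)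
      field_simp; ring
    refine (ENNReal.add_lt_add_of_lt_of_le ?_ h1 h2).trans_le ?_
    · exact (h2.trans_lt ENNReal.ofReal_lt_top).ne
    · rw [← ENNReal.ofReal_add (by positivity) (by positivity)]
      exact ENNReal.ofReal_le_ofReal (by linarith)
  exact absurd (hLHS ▸ hint) (not_le.2 hRHS)

/-! ### Likelihood ratios in the location family -/

variable {d : ℕ} {V : Euc d → ℝ}

theorem abs_second_difference_le {E : Type*} [NormedAddCommGroup E] [NormedSpace ℝ E]
    {V : E → ℝ} (hV : ContDiff ℝ 2 V) {M : ℝ} (hM : ∀ x, ‖iteratedFDeriv ℝ 2 V x‖ ≤ M)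
    (x h : E) : |V (x + h) + V (x - h) - 2 * V x| ≤ 2 * M * ‖h‖ ^ 2 := by
  have hd : Differentiable ℝ V := hV.differentiable (by norm_num)
  have hd' : Differentiable ℝ (fderiv ℝ V) :=
    (hV.fderiv_right (m := 1) (by norm_num)).differentiable (by norm_num)
  have hlip : ∀ y, ‖fderiv ℝ V y - fderiv ℝ V x‖ ≤ M * ‖y - x‖ := by
    intro y
    refine convex_univ.norm_image_sub_le_of_norm_fderiv_le (𝕜 := ℝ) (fun z _ => hd' z)
      (fun z _ => ?_) (Set.mem_univ x) (Set.mem_univ y)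
    rw [← norm_iteratedFDeriv_one, norm_iteratedFDeriv_fderiv]
    exact hM z
  have hM0 : 0 ≤ M := (norm_nonneg _).trans (hM x)
  have htaylor : ∀ k : E, ‖k‖ = ‖h‖ → |V (x + k) - V x - fderiv ℝ V x k| ≤ M * ‖h‖ ^ 2 := by
    intro k hk
    have := (convex_closedBall x ‖h‖).norm_image_sub_le_of_norm_fderiv_le' (𝕜 := ℝ)
      (f := V) (φ := fderiv ℝ V x) (C := M * ‖h‖) (fun z _ => hd z)
      (fun z hz => (hlip z).trans (by
        rw [Metric.mem_closedBall, dist_eq_norm] at hz; gcongr))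
      (x := x) (y := x + k) (by simp) (by simp [hk])
    rw [add_sub_cancel_left, hk, Real.norm_eq_abs] at this
    exact this.trans (le_of_eq (by ring))
  have h1 := abs_le.1 (htaylor h rfl)
  have h2 := abs_le.1 (htaylor (-h) (norm_neg h))
  rw [map_neg, ← sub_eq_add_neg] at h2
  exact abs_le.2 ⟨by linarith [h1.1, h2.1], by linarith [h1.2, h2.2]⟩

theorem isProbabilityMeasure_locationMeasure
    (hV : ∫⁻ x : Euc d, ENNReal.ofReal (Real.exp (-V x)) = 1) (θ : Euc d) :
    IsProbabilityMeasure (locationMeasure V θ) := by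
  refine ⟨?_⟩
  rw [locationMeasure, withDensity_apply _ MeasurableSet.univ, Measure.restrict_univ,
    lintegral_sub_right_eq_self (fun x => ENNReal.ofReal (Real.exp (-V x))) θ, hV]

theorem locationMeasure_eq_withDensity (hV : Measurable V) (θ : Euc d) :
    locationMeasure V θ = (locationMeasure V 0).withDensity
      (fun x => ENNReal.ofReal (Real.exp (V x - V (x - θ)))) := by
  have h2 : Measurable fun x => V (x - θ) := hV.comp (measurable_id.sub_const θ)
  rw [locationMeasure, locationMeasure, ← withDensity_mul _ (by simpa using by fun_prop)
    (by fun_prop)]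
  congr 1
  ext x
  rw [Pi.mul_apply, ← ENNReal.ofReal_mul (Real.exp_nonneg _), ← Real.exp_add]
  congr 2
  rw [sub_zero]
  ring

/-- The likelihood ratio of the sample of size `n` at the location `θ` against the location `0`. -/
def likelihoodRatio (V : Euc d → ℝ) (n : ℕ) (θ : Euc d) (X : Fin n → Euc d) : ℝ :=
  ∏ k, Real.exp (V (X k) - V (X k - θ))

theorem measurable_likelihoodRatio (hV : Measurable V) (n : ℕ) (θ : Euc d) :
    Measurable (likelihoodRatio V n θ) := by
  unfold likelihoodRatio
  refine Finset.measurable_prod _ fun k _ => ?_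
  have h1 : Measurable fun X : Fin n → Euc d => V (X k) := hV.comp (measurable_pi_apply k)
  have h2 : Measurable fun X : Fin n → Euc d => V (X k - θ) :=
    hV.comp (Measurable.sub_const (measurable_pi_apply (X := fun _ : Fin n => Euc d) k) θ)
  fun_prop

theorem sampleMeasure_eq_withDensity (hV : Measurable V)
    (hV1 : ∫⁻ x : Euc d, ENNReal.ofReal (Real.exp (-V x)) = 1) (n : ℕ) (θ : Euc d) :
    sampleMeasure V n θ = (sampleMeasure V n 0).withDensity
      (fun X => ENNReal.ofReal (likelihoodRatio V n θ X)) := by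
  have hP := isProbabilityMeasure_locationMeasure hV1
  have h2 : Measurable fun x => V (x - θ) := hV.comp (measurable_id.sub_const θ)
  have hθ := hP θ
  rw [locationMeasure_eq_withDensity hV] at hθ
  rw [sampleMeasure, locationMeasure_eq_withDensity hV]
  rw [pi_withDensity (fun _ : Fin n => locationMeasure V 0) (fun _ => by fun_prop)]
  simp only [likelihoodRatio, sampleMeasure]
  congr 1
  ext X
  rw [ENNReal.ofReal_prod_of_nonneg fun _ _ => Real.exp_nonneg _]

/-- By the bound on the second difference, the square of the likelihood ratio of one observation
at `θ` is at most `exp (2 M ‖θ‖²)` times the likelihood ratio at `2 θ`, which integrates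
to one. -/
theorem lintegral_likelihoodRatio_sq_le (hV : ContDiff ℝ 2 V)
    (hV1 : ∫⁻ x : Euc d, ENNReal.ofReal (Real.exp (-V x)) = 1) {M : ℝ}
    (hM : ∀ x, ‖iteratedFDeriv ℝ 2 V x‖ ≤ M) (n : ℕ) (θ : Euc d) :
    ∫⁻ X, ENNReal.ofReal (likelihoodRatio V n θ X ^ 2) ∂sampleMeasure V n 0 ≤
      ENNReal.ofReal (Real.exp (2 * M * n * ‖θ‖ ^ 2)) := by
  have hP := isProbabilityMeasure_locationMeasure hV1
  have hn := (sampleMeasure_eq_withDensity hV.continuous.measurable hV1 n (2 • θ))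
  have hprob : ∫⁻ X, ENNReal.ofReal (likelihoodRatio V n (2 • θ) X) ∂sampleMeasure V n 0 = 1 := by
    have : IsProbabilityMeasure (sampleMeasure V n (2 • θ)) := by
      unfold sampleMeasure; infer_instance
    have h := measure_univ (μ := sampleMeasure V n (2 • θ))
    rwa [hn, withDensity_apply _ MeasurableSet.univ, Measure.restrict_univ] at h
  have hpt : ∀ X, likelihoodRatio V n θ X ^ 2 ≤
      Real.exp (2 * M * n * ‖θ‖ ^ 2) * likelihoodRatio V n (2 • θ) X := by
    intro X
    have hconst : Real.exp (2 * M * n * ‖θ‖ ^ 2) =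
        ∏ _k : Fin n, Real.exp (2 * M * ‖θ‖ ^ 2) := by
      rw [Finset.prod_const, Finset.card_univ, Fintype.card_fin, ← Real.exp_nat_mul]
      congr 1; ring
    rw [hconst, likelihoodRatio, likelihoodRatio, ← Finset.prod_pow, ← Finset.prod_mul_distrib]
    refine Finset.prod_le_prod (fun _ _ => by positivity) fun k _ => ?_
    rw [← Real.exp_nat_mul, ← Real.exp_add, Real.exp_le_exp]
    have h := (abs_le.1 (abs_second_difference_le hV hM (X k - θ) θ)).2
    rw [sub_add_cancel, sub_sub, ← two_nsmul] at h
    push_cast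
    linarith
  calc ∫⁻ X, ENNReal.ofReal (likelihoodRatio V n θ X ^ 2) ∂sampleMeasure V n 0
      ≤ ∫⁻ X, ENNReal.ofReal (Real.exp (2 * M * n * ‖θ‖ ^ 2)) *
          ENNReal.ofReal (likelihoodRatio V n (2 • θ) X) ∂sampleMeasure V n 0 := by
        refine lintegral_mono fun X => ?_
        rw [← ENNReal.ofReal_mul (Real.exp_nonneg _)]
        exact ENNReal.ofReal_le_ofReal (hpt X)
    _ = ENNReal.ofReal (Real.exp (2 * M * n * ‖θ‖ ^ 2)) := by
        rw [lintegral_const_mul _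
          (measurable_likelihoodRatio hV.continuous.measurable n _).ennreal_ofReal, hprob, mul_one]

/-- Lower bound for the minimax risk from finitely many parameters `θ i`, near enough to the origin
relative to their number, at which functions in the Hölder ball take values `± c` with
arbitrary signs. -/
theorem le_minimaxRisk (hV : ContDiff ℝ 2 V)
    (hV1 : ∫⁻ x : Euc d, ENNReal.ofReal (Real.exp (-V x)) = 1) {M : ℝ}
    (hM : ∀ x, ‖iteratedFDeriv ℝ 2 V x‖ ≤ M) {n : ℕ} {s : ℝ} {ι : Type*} [Fintype ι] [Nonempty ι]
    (θ : ι → Euc d) (hθ : ∀ i, ‖θ i‖ ≤ 1)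
    (hθ2 : ∀ i, Real.exp (2 * M * n * ‖θ i‖ ^ 2) ≤ 3 / 4 * Fintype.card ι) {c : ℝ} (hc : 0 < c)
    (hf : ∀ σ : ι → ℝ, (∀ i, σ i = 1 ∨ σ i = -1) →
      ∃ f : Euc d → ℝ, holderNorm s f ≤ 1 ∧ ∀ i, f (θ i) = c * σ i) :
    ENNReal.ofReal (c / 8) ≤ minimaxRisk V n s := by
  have hP := isProbabilityMeasure_locationMeasure hV1
  have hPn : ∀ θ, IsProbabilityMeasure (sampleMeasure V n θ) := fun θ => by
    unfold sampleMeasure; infer_instance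
  have hmeas := hV.continuous.measurable
  have hone : ∀ i, ∫⁻ X, ENNReal.ofReal (likelihoodRatio V n (θ i) X) ∂sampleMeasure V n 0 = 1 := by
    intro i
    have h := (hPn (θ i)).measure_univ
    rwa [sampleMeasure_eq_withDensity hmeas hV1, withDensity_apply _ MeasurableSet.univ,
      Measure.restrict_univ] at h
  obtain ⟨σ, hσ, hT⟩ := exists_signs_forall_estimator (sampleMeasure V n 0)
    (fun i => measurable_likelihoodRatio hmeas n (θ i))
    (fun i X => Finset.prod_nonneg fun _ _ => Real.exp_nonneg _) hone
    (fun i => (lintegral_likelihoodRatio_sq_le hV hV1 hM n (θ i)).trans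
      (ENNReal.ofReal_le_ofReal (hθ2 i)))
  obtain ⟨f, hfn, hfθ⟩ := hf σ hσ
  refine le_iSup₂_of_le f hfn (le_iInf₂ fun T hTm => ?_)
  obtain ⟨i, hi⟩ := hT T hTm c hc
  refine le_iSup₂_of_le (θ i) (hθ i) (hi.trans ?_)
  rw [← sampleMeasure_eq_withDensity hmeas hV1, ← hfθ, risk, ← eLpNorm_one_eq_lintegral_enorm]
  exact eLpNorm_le_eLpNorm_of_exponent_le (by norm_num) (by fun_prop)

/-! ### Functions in the Hölder ball -/

theorem holderOrder_lt {s : ℝ} (hs : 0 < s) : (holderOrder s : ℝ) < s := by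
  have h1 : 0 < ⌈s⌉₊ := Nat.ceil_pos.2 hs
  have h2 : holderOrder s < ⌈s⌉₊ := Nat.sub_lt h1 one_pos
  exact Nat.lt_ceil.1 h2

theorem le_holderOrder_add_one (s : ℝ) : s ≤ holderOrder s + 1 := by
  have h1 : ⌈s⌉₊ ≤ holderOrder s + 1 := by unfold holderOrder; omega
  exact_mod_cast (Nat.le_ceil s).trans (Nat.cast_le.2 h1)

/-- A function that varies on the scale `δ`, with derivatives of size at most `δ ^ (s - j) / 2`, is
in the unit ball of `C^s`. The Hölder seminorm is controlled by the derivative of order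
`l + 1` at distances below `δ` and by the one of order `l` at larger distances. -/
theorem holderNorm_le_one {d : ℕ} {s : ℝ} (hs : 0 < s) {f : Euc d → ℝ}
    (hf : ContDiff ℝ (holderOrder s + 1 : ℕ) f) {δ : ℝ} (hδ : 0 < δ) (hδ1 : δ ≤ 1)
    (h : ∀ j ≤ holderOrder s + 1, ∀ x, ‖iteratedFDeriv ℝ j f x‖ ≤ δ ^ (s - j) / 2) :
    holderNorm s f ≤ 1 := by
  set l := holderOrder s with hl
  have hls : (l : ℝ) < s := holderOrder_lt hs
  have hsl : s ≤ l + 1 := le_holderOrder_add_one s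
  rw [holderNorm, if_pos (hf.of_le (by exact_mod_cast Nat.le_succ l))]
  refine max_le (iSup₂_le fun j hj => iSup_le fun x => ?_)
    (iSup_le fun x => iSup_le fun y => iSup_le fun hxy => ?_)
  · have hjl : j ≤ l := Nat.lt_succ_iff.1 (Finset.mem_range.1 hj)
    have h0 : (j : ℝ) ≤ l := by exact_mod_cast hjl
    have h1 : δ ^ (s - j) ≤ 1 := Real.rpow_le_one hδ.le hδ1 (by linarith)
    rw [← ofReal_norm, ENNReal.ofReal_le_one]
    linarith [h j (by omega) x]
  · set ρ : ℝ := s - l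
    have hρ0 : 0 < ρ := by simp only [ρ]; linarith
    have hρ1 : ρ ≤ 1 := by simp only [ρ]; linarith
    set t := ‖x - y‖ with ht
    have ht0 : 0 < t := norm_pos_iff.2 (sub_ne_zero.2 hxy)
    have key : ‖iteratedFDeriv ℝ l f x - iteratedFDeriv ℝ l f y‖ ≤ t ^ ρ := by
      rcases le_total t δ with htδ | htδ
      · have hd : Differentiable ℝ (iteratedFDeriv ℝ l f) :=
          hf.differentiable_iteratedFDeriv (by exact_mod_cast Nat.lt_succ_self l)
        have h1 := convex_univ.norm_image_sub_le_of_norm_fderiv_le (𝕜 := ℝ)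
          (f := iteratedFDeriv ℝ l f) (fun z _ => hd z)
          (fun z _ => by rw [norm_fderiv_iteratedFDeriv]; exact h (l + 1) le_rfl z)
          (Set.mem_univ y) (Set.mem_univ x)
        refine h1.trans ?_
        have h2 : δ ^ (s - (l + 1 : ℕ)) ≤ t ^ (s - (l + 1 : ℕ)) :=
          Real.rpow_le_rpow_of_nonpos ht0 htδ (by push_cast; linarith)
        have h3 : t ^ ρ = t ^ (s - (l + 1 : ℕ)) * t := by
          rw [← Real.rpow_add_one ht0.ne']; congr 1; push_cast; ring
        rw [h3, ← ht]
        have := Real.rpow_nonneg hδ.le (s - (l + 1 : ℕ))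
        gcongr
        linarith
      · have h2 : δ ^ ρ ≤ t ^ ρ := Real.rpow_le_rpow hδ.le htδ hρ0.le
        have h3 := norm_sub_le (iteratedFDeriv ℝ l f x) (iteratedFDeriv ℝ l f y)
        linarith [h l (by omega) x, h l (by omega) y]
    rw [← ofReal_norm, ← ofReal_norm, ← ht,
      ENNReal.ofReal_rpow_of_pos ht0, ← ENNReal.ofReal_div_of_pos (Real.rpow_pos_of_pos ht0 _),
      ENNReal.ofReal_le_one]
    exact div_le_one_of_le₀ key (Real.rpow_nonneg ht0.le _)

/-- A smooth bump function with value `1` at the origin and support in the closed unit ball, a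
function of the norm alone. -/
def bump {E : Type*} [NormedAddCommGroup E] (x : E) : ℝ :=
  Real.smoothTransition (1 - ‖x‖ ^ 2)

section Bump

theorem bump_zero {E : Type*} [NormedAddCommGroup E] : bump (0 : E) = 1 := by simp [bump]

theorem bump_eq_zero {E : Type*} [NormedAddCommGroup E] {x : E} (hx : 1 ≤ ‖x‖) : bump x = 0 :=
  Real.smoothTransition.zero_of_nonpos (by nlinarith)

variable {E : Type*} [NormedAddCommGroup E] [InnerProductSpace ℝ E]

theorem contDiff_bump {n : ℕ} : ContDiff ℝ n (bump : E → ℝ) :=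
  Real.smoothTransition.contDiff.comp (contDiff_const.sub (contDiff_norm_sq ℝ))

theorem norm_iteratedFDeriv_id_le_one {x : E} (hx : ‖x‖ ≤ 1) (i : ℕ) :
    ‖iteratedFDeriv ℝ i (id : E → E) x‖ ≤ 1 := by
  match i with
  | 0 => simpa using hx
  | 1 => rw [norm_iteratedFDeriv_one, fderiv_id]; exact ContinuousLinearMap.norm_id_le
  | i + 2 =>
    have h : fderiv ℝ (id : E → E) = fun _ => ContinuousLinearMap.id ℝ E :=
      funext fun _ => fderiv_id
    rw [← norm_iteratedFDeriv_fderiv, h, iteratedFDeriv_const_of_ne (by omega)]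
    simp

theorem norm_iteratedFDeriv_one_sub_norm_sq_le {x : E} (hx : ‖x‖ ≤ 1) {i : ℕ} (hi : 1 ≤ i) :
    ‖iteratedFDeriv ℝ i (fun y : E => 1 - ‖y‖ ^ 2) x‖ ≤ 2 ^ i := by
  have h1 : iteratedFDeriv ℝ i (fun y : E => 1 - ‖y‖ ^ 2) x =
      -iteratedFDeriv ℝ i (fun y : E => ‖y‖ ^ 2) x := by
    rw [fun_iteratedFDeriv_sub_apply contDiffAt_const (contDiff_norm_sq ℝ).contDiffAt,
      iteratedFDeriv_const_of_ne (by omega)]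
    simp
  have h2 : (fun y : E => ‖y‖ ^ 2) = fun y => innerSL ℝ (id y) (id y) := by
    ext y; simp
  rw [h1, norm_neg, h2]
  have h3 := (innerSL ℝ : E →L[ℝ] E →L[ℝ] ℝ).norm_iteratedFDeriv_le_of_bilinear_of_le_one
    (f := (id : E → E)) (g := (id : E → E)) (N := i) contDiff_id contDiff_id x le_rfl
    (norm_innerSL_le ℝ)
  refine h3.trans ?_
  calc ∑ k ∈ Finset.range (i + 1), (i.choose k : ℝ) * ‖iteratedFDeriv ℝ k (id : E → E) x‖ *
        ‖iteratedFDeriv ℝ (i - k) (id : E → E) x‖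
      ≤ ∑ k ∈ Finset.range (i + 1), (i.choose k : ℝ) * 1 * 1 := by
        gcongr <;> exact norm_iteratedFDeriv_id_le_one hx _
    _ = 2 ^ i := by
        simp only [mul_one]
        exact_mod_cast Nat.sum_range_choose i

theorem iteratedFDeriv_bump_eq_zero {x : E} (hx : 1 < ‖x‖) (i : ℕ) :
    iteratedFDeriv ℝ i (bump : E → ℝ) x = 0 := by
  have h : (bump : E → ℝ) =ᶠ[nhds x] fun _ => 0 := by
    filter_upwards [(isOpen_lt continuous_const continuous_norm).mem_nhds hx] with y hy
    exact bump_eq_zero (le_of_lt hy)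
  rw [h.iteratedFDeriv ℝ i |>.eq_of_nhds]
  simp

/-- The derivatives of the bump function are bounded independently of the dimension, because those
of the squared norm are. -/
theorem exists_norm_iteratedFDeriv_bump_le (l : ℕ) : ∃ A : ℝ, 1 ≤ A ∧
    ∀ (d : ℕ), ∀ j ≤ l, ∀ x : Euc d, ‖iteratedFDeriv ℝ j (bump : Euc d → ℝ) x‖ ≤ A := by
  have hC : ∀ i : ℕ, ∃ C, ∀ y ∈ Set.Icc (0 : ℝ) 1,
      ‖iteratedFDeriv ℝ i Real.smoothTransition y‖ ≤ C := fun i =>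
    isCompact_Icc.exists_bound_of_continuousOn
      ((Real.smoothTransition.contDiff (n := i)).continuous_iteratedFDeriv
        (m := i) le_rfl).continuousOn
  choose C hC using hC
  set K : ℝ := 1 + ∑ i ∈ Finset.range (l + 1), |C i| with hK
  have hK1 : 1 ≤ K := by
    have : 0 ≤ ∑ i ∈ Finset.range (l + 1), |C i| := Finset.sum_nonneg fun _ _ => abs_nonneg _
    linarith
  have hCK : ∀ i ≤ l, C i ≤ K := by
    intro i hi
    have : |C i| ≤ ∑ i ∈ Finset.range (l + 1), |C i| :=
      Finset.single_le_sum (f := fun i => |C i|) (fun _ _ => abs_nonneg _)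
        (Finset.mem_range.2 (by omega))
    linarith [le_abs_self (C i)]
  have hfac : (1 : ℝ) ≤ l.factorial := by exact_mod_cast Nat.one_le_iff_ne_zero.2 l.factorial_ne_zero
  refine ⟨l.factorial * K * 2 ^ l, ?_, fun d j hj x => ?_⟩
  · have : (1 : ℝ) ≤ 2 ^ l := one_le_pow₀ (by norm_num)
    have h2 : 1 ≤ l.factorial * K := one_le_mul_of_one_le_of_one_le hfac hK1
    exact one_le_mul_of_one_le_of_one_le h2 this
  · rcases le_or_gt ‖x‖ 1 with hx | hx
    · have h1 : ‖iteratedFDeriv ℝ j (Real.smoothTransition ∘ fun y : Euc d => 1 - ‖y‖ ^ 2) x‖ ≤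
          j.factorial * K * 2 ^ j := by
        refine norm_iteratedFDeriv_comp_le (N := j) Real.smoothTransition.contDiff
          (contDiff_const.sub (contDiff_norm_sq ℝ)) le_rfl x (fun i hi => ?_)
          (fun i hi _ => norm_iteratedFDeriv_one_sub_norm_sq_le hx hi)
        refine (hC i _ ⟨?_, ?_⟩).trans (hCK i (hi.trans hj))
        · have := pow_le_one₀ (n := 2) (norm_nonneg x) hx
          linarith
        · have := sq_nonneg ‖x‖
          linarith
      refine h1.trans ?_
      gcongr
      norm_num
    · rw [iteratedFDeriv_bump_eq_zero hx, norm_zero]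
      positivity

end Bump

theorem norm_iteratedFDeriv_comp_smul_sub {E F : Type*} [NormedAddCommGroup E] [NormedSpace ℝ E]
    [NormedAddCommGroup F] [NormedSpace ℝ F] {g : E → F} {j : ℕ} (hg : ContDiff ℝ j g) (r : ℝ)
    (θ x : E) :
    ‖iteratedFDeriv ℝ j (fun y => g (r • (y - θ))) x‖ =
      |r| ^ j * ‖iteratedFDeriv ℝ j g (r • (x - θ))‖ := by
  rw [iteratedFDeriv_comp_sub (f := fun y => g (r • y)) j θ x, iteratedFDeriv_comp_const_smul r hg,
    norm_smul, norm_pow, Real.norm_eq_abs]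

/-- At every point at most one of the bumps is nonzero, so the derivatives of the sum obey the
same bound as those of a single bump. -/
theorem exists_holderNorm_le_one_of_separated {d : ℕ} {s : ℝ} (hs : 0 < s) {A : ℝ} (hA : 0 < A)
    (hbump : ∀ j ≤ holderOrder s + 1, ∀ x : Euc d, ‖iteratedFDeriv ℝ j (bump : Euc d → ℝ) x‖ ≤ A)
    {ι : Type*} [Fintype ι] {θ : ι → Euc d} {δ : ℝ} (hδ : 0 < δ) (hδ1 : δ ≤ 1)
    (hθ : ∀ i j, i ≠ j → 2 * δ < ‖θ i - θ j‖) {σ : ι → ℝ} (hσ : ∀ i, σ i = 1 ∨ σ i = -1) :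
    ∃ f : Euc d → ℝ, holderNorm s f ≤ 1 ∧ ∀ i, f (θ i) = δ ^ s / (2 * A) * σ i := by
  classical
  set κ : ℝ := δ ^ s / (2 * A) with hκ
  have hκ0 : 0 < κ := by positivity
  set b : ι → Euc d → ℝ := fun i x => bump (δ⁻¹ • (x - θ i))
  have hb : ∀ i (k : ℕ), ContDiff ℝ k (b i) := fun i k =>
    contDiff_bump.comp ((contDiff_id.sub contDiff_const).const_smul δ⁻¹)
  have hσ1 : ∀ i, |σ i| = 1 := fun i => by rcases hσ i with h | h <;> simp [h]
  refine ⟨fun x => ∑ i, (κ * σ i) • b i x, ?_, fun i => ?_⟩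
  · refine holderNorm_le_one hs (ContDiff.sum fun i _ => (hb i _).const_smul _) hδ hδ1
      fun j hj x => ?_
    have hterm : ∀ i, iteratedFDeriv ℝ j (fun y => (κ * σ i) • b i y) x =
        (κ * σ i) • iteratedFDeriv ℝ j (b i) x := fun i =>
      iteratedFDeriv_const_smul_apply' (hb i j).contDiffAt
    have hnorm : ∀ i, ‖iteratedFDeriv ℝ j (b i) x‖ =
        (δ⁻¹) ^ j * ‖iteratedFDeriv ℝ j (bump : Euc d → ℝ) (δ⁻¹ • (x - θ i))‖ := fun i => by
      rw [norm_iteratedFDeriv_comp_smul_sub contDiff_bump, abs_of_pos (inv_pos.2 hδ)]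
    have hzero : ∀ i, δ < ‖x - θ i‖ → iteratedFDeriv ℝ j (b i) x = 0 := fun i hi => by
      rw [← norm_eq_zero, hnorm, iteratedFDeriv_bump_eq_zero, norm_zero, mul_zero]
      rw [norm_smul, norm_inv, Real.norm_eq_abs, abs_of_pos hδ, lt_inv_mul_iff₀ hδ]
      simpa using hi
    have hbound : ∀ i, ‖(κ * σ i) • iteratedFDeriv ℝ j (b i) x‖ ≤ δ ^ (s - j) / 2 := fun i => by
      rw [norm_smul, norm_mul, Real.norm_eq_abs, Real.norm_eq_abs, hσ1, abs_of_pos hκ0, hnorm,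
        Real.rpow_sub hδ, Real.rpow_natCast]
      calc κ * 1 * ((δ⁻¹) ^ j * ‖iteratedFDeriv ℝ j (bump : Euc d → ℝ) (δ⁻¹ • (x - θ i))‖)
          ≤ κ * 1 * ((δ⁻¹) ^ j * A) := by gcongr; exact hbump j hj _
        _ = δ ^ s / δ ^ j / 2 := by rw [hκ, inv_pow]; field_simp
    rw [iteratedFDeriv_fun_sum_apply fun i _ => ((hb i j).const_smul _).contDiffAt]
    simp_rw [hterm]
    by_cases hx : ∃ i, ‖x - θ i‖ ≤ δ
    · obtain ⟨i, hi⟩ := hx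
      -- the centers are more than `2 δ` apart, so only the bump at `θ i` reaches `x`
      rw [Finset.sum_eq_single i]
      · exact hbound i
      · intro k _ hk
        rw [hzero k, smul_zero]
        have h1 := hθ i k (Ne.symm hk)
        have h2 := norm_sub_le (x - θ k) (x - θ i)
        rw [sub_sub_sub_cancel_left] at h2
        linarith
      · simp
    · push Not at hx
      rw [Finset.sum_eq_zero fun i _ => by rw [hzero i (hx i), smul_zero], norm_zero]
      positivity
  · simp only [smul_eq_mul]
    rw [Finset.sum_eq_single i]
    · simp [b, bump_zero]
    · intro k _ hk
      have h1 := hθ i k (Ne.symm hk)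
      have : b k (θ i) = 0 := bump_eq_zero (by
        rw [norm_smul, norm_inv, Real.norm_eq_abs, abs_of_pos hδ, le_inv_mul_iff₀ hδ]
        linarith)
      rw [this, mul_zero]
    · simp

/-- The function `sin ⟪e, x⟫ / 2` takes opposite values at `± t e`, a constant takes equal
ones. -/
theorem exists_holderNorm_le_one_of_antipodal {d : ℕ} {s : ℝ} (hs : 0 < s) {e : Euc d}
    (he : ‖e‖ = 1) (t : ℝ) {σ : Bool → ℝ} (hσ : ∀ i, σ i = 1 ∨ σ i = -1) :
    ∃ f : Euc d → ℝ, holderNorm s f ≤ 1 ∧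
      ∀ i : Bool, f (if i then t • e else -(t • e)) = Real.sin t / 2 * σ i := by
  have hsin1 : |Real.sin t| ≤ 1 := Real.abs_sin_le_one t
  by_cases hc : σ true = σ false
  · refine ⟨fun _ => Real.sin t / 2 * σ true, ?_, fun i => by cases i <;> simp [hc]⟩
    refine holderNorm_le_one hs contDiff_const one_pos le_rfl fun j _ x => ?_
    rw [Real.one_rpow]
    rcases Nat.eq_zero_or_pos j with rfl | hj
    · have h1 : |σ true| = 1 := by rcases hσ true with h | h <;> simp [h]
      rw [norm_iteratedFDeriv_zero, Real.norm_eq_abs, abs_mul, h1, abs_div, abs_two]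
      linarith
    · rw [iteratedFDeriv_const_of_ne (by omega)]
      simp
  · have hne : σ false = -σ true := by
      rcases hσ true with h | h <;> rcases hσ false with h' | h' <;> simp_all
    set φ : Euc d → ℝ := Real.sin ∘ innerSL ℝ e with hφ
    have hφc : ∀ k : ℕ, ContDiff ℝ k φ := fun k =>
      Real.contDiff_sin.comp (innerSL ℝ e).contDiff
    refine ⟨fun x => (σ true / 2) • φ x, ?_, fun i => ?_⟩
    · refine holderNorm_le_one hs ((hφc _).const_smul _) one_pos le_rfl fun j _ x => ?_
      have h1 : |σ true| = 1 := by rcases hσ true with h | h <;> simp [h]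
      rw [iteratedFDeriv_const_smul_apply' (hφc j).contDiffAt, norm_smul, Real.one_rpow,
        Real.norm_eq_abs, abs_div, h1, abs_two]
      have h2 : ‖iteratedFDeriv ℝ j φ x‖ ≤ 1 := by
        rw [hφ, (innerSL ℝ e).iteratedFDeriv_comp_right (n := j) Real.contDiff_sin x le_rfl]
        refine (ContinuousMultilinearMap.norm_compContinuousLinearMap_le _ _).trans ?_
        rw [norm_iteratedFDeriv_eq_norm_iteratedDeriv]
        simpa [he] using Real.abs_iteratedDeriv_sin_le_one j _
      linarith
    · cases i <;> simp [φ, inner_smul_right, he, hne] <;> ring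

/-! ### Separated points in the unit ball -/

/-- Fewer than `2 ^ d` balls of radius `1 / 2` do not cover the unit ball, by volume, so the set of
points can be enlarged one by one. -/
theorem exists_separated_finset_card_eq {d : ℕ} (k : ℕ) (hk : k ≤ 2 ^ d) :
    ∃ t : Finset (Euc d), t.card = k ∧ (∀ u ∈ t, ‖u‖ ≤ 1) ∧
      ∀ u ∈ t, ∀ v ∈ t, u ≠ v → 1 / 2 ≤ ‖u - v‖ := by
  classical
  induction k with
  | zero => exact ⟨∅, by simp⟩
  | succ k ih =>
    obtain ⟨t, htk, ht1, ht2⟩ := ih (by omega)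
    have hex : ∃ x : Euc d, ‖x‖ ≤ 1 ∧ ∀ u ∈ t, 1 / 2 ≤ ‖x - u‖ := by
      by_contra! hcon
      have hcov : Metric.ball (0 : Euc d) 1 ⊆ ⋃ u ∈ t, Metric.ball u (1 / 2) := by
        intro x hx
        obtain ⟨u, hu, hxu⟩ := hcon x (by simpa using (mem_ball_zero_iff.1 hx).le)
        exact Set.mem_biUnion hu (by rwa [Metric.mem_ball, dist_eq_norm])
      have hvol : volume (Metric.ball (0 : Euc d) 1) ≤
          ENNReal.ofReal (k * (1 / 2) ^ d) * volume (Metric.ball (0 : Euc d) 1) := by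
        refine (measure_mono hcov).trans ((measure_biUnion_finset_le _ _).trans (le_of_eq ?_))
        have : ∀ u : Euc d, volume (Metric.ball u (1 / 2)) =
            ENNReal.ofReal ((1 / 2) ^ d) * volume (Metric.ball (0 : Euc d) 1) := fun u => by
          rw [Measure.addHaar_ball_of_pos volume u (by norm_num : (0 : ℝ) < 1 / 2)]
          simp
        simp_rw [this]
        rw [Finset.sum_const, htk, nsmul_eq_mul, ← mul_assoc, ENNReal.ofReal_mul (by positivity),
          ENNReal.ofReal_natCast]
      have hlt : (k : ℝ) * (1 / 2) ^ d < 1 := by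
        have : (k : ℝ) < 2 ^ d := by exact_mod_cast hk
        rw [one_div, inv_pow, ← div_eq_mul_inv, div_lt_one (by positivity)]
        exact this
      have hpos : 0 < volume (Metric.ball (0 : Euc d) 1) := Metric.measure_ball_pos _ _ one_pos
      have hfin : volume (Metric.ball (0 : Euc d) 1) ≠ ∞ := measure_ball_lt_top.ne
      refine absurd hvol (not_le.2 ?_)
      calc _ < 1 * volume (Metric.ball (0 : Euc d) 1) :=
            ENNReal.mul_lt_mul_left hpos.ne' hfin (by rwa [ENNReal.ofReal_lt_one])
        _ = _ := one_mul _
    obtain ⟨x, hx1, hx2⟩ := hex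
    have hxt : x ∉ t := fun h => by
      have := hx2 x h
      norm_num at this
    refine ⟨insert x t, by rw [Finset.card_insert_of_notMem hxt, htk], ?_, ?_⟩
    · intro u hu
      rcases Finset.mem_insert.1 hu with rfl | hu
      exacts [hx1, ht1 u hu]
    · intro u hu v hv huv
      rcases Finset.mem_insert.1 hu with rfl | hu' <;> rcases Finset.mem_insert.1 hv with rfl | hv'
      · exact absurd rfl huv
      · exact hx2 v hv'
      · rw [norm_sub_rev]; exact hx2 u hu'
      · exact ht2 u hu' v hv' huv

/-! ### The two rates -/

/-- A radius `a` for which points at distance `a √(k / n)` from the origin have likelihood ratios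
with second moment at most `(3 / 2) ^ k`. -/
theorem exists_radius {M : ℝ} (hM : 0 < M) :
    ∃ a : ℝ, 0 < a ∧ a ≤ 1 ∧ ∀ (n k : ℕ) (r : ℝ), n * r ^ 2 ≤ k * a ^ 2 →
      Real.exp (2 * M * n * r ^ 2) ≤ (3 / 2) ^ k := by
  refine ⟨min 1 √(1 / (6 * M)), lt_min one_pos (Real.sqrt_pos.2 (by positivity)),
    min_le_left _ _, fun n k r h => ?_⟩
  set a := min 1 √(1 / (6 * M))
  have ha0 : 0 ≤ a := le_min zero_le_one (Real.sqrt_nonneg _)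
  have ha : a ^ 2 ≤ 1 / (6 * M) := by
    rw [← Real.sq_sqrt (show 0 ≤ 1 / (6 * M) by positivity)]
    gcongr
    exact min_le_right _ _
  have hMa : 2 * M * a ^ 2 ≤ 1 / 3 := by
    rw [le_div_iff₀ (by positivity)] at ha
    linarith
  have hexp : Real.exp (1 / 3) ≤ 3 / 2 := by
    have h1 := Real.one_sub_le_exp_neg (1 / 3)
    rw [Real.exp_neg, le_inv_comm₀ (by norm_num) (Real.exp_pos _)] at h1
    exact h1.trans (by norm_num)
  calc Real.exp (2 * M * n * r ^ 2) ≤ Real.exp (k * (1 / 3)) := by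
        rw [Real.exp_le_exp]
        calc 2 * M * n * r ^ 2 = 2 * M * (n * r ^ 2) := by ring
          _ ≤ 2 * M * (k * a ^ 2) := by gcongr
          _ = k * (2 * M * a ^ 2) := by ring
          _ ≤ k * (1 / 3) := by gcongr
    _ = Real.exp (1 / 3) ^ k := Real.exp_nat_mul _ _
    _ ≤ (3 / 2) ^ k := by gcongr

/-- The parametric rate `1 / √n`, from two points at distance of order `1 / √n`. -/
theorem exists_parametric_le_minimaxRisk {M : ℝ} (hM : 0 < M) :
    ∃ c : ℝ, 0 < c ∧ ∀ (s : ℝ), 0 < s → ∀ (n d : ℕ), 1 ≤ n → 1 ≤ d → ∀ V : Euc d → ℝ,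
      ContDiff ℝ 2 V → ∫⁻ x : Euc d, ENNReal.ofReal (Real.exp (-V x)) = 1 →
      (∀ x, ‖iteratedFDeriv ℝ 2 V x‖ ≤ M) →
        ENNReal.ofReal (c * (1 / √(n : ℝ))) ≤ minimaxRisk V n s := by
  obtain ⟨a, ha, ha1, hexp⟩ := exists_radius hM
  refine ⟨a / 32, by positivity, fun s hs n d hn hd V hV hV1 hVM => ?_⟩
  have hn0 : (0 : ℝ) < n := by exact_mod_cast hn
  set e : Euc d := EuclideanSpace.single ⟨0, hd⟩ 1
  have he : ‖e‖ = 1 := by simp [e]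
  set t : ℝ := a / √(n : ℝ) with ht
  have hsq1 : 1 ≤ √(n : ℝ) := Real.one_le_sqrt.2 (by exact_mod_cast hn)
  have ht0 : 0 < t := by positivity
  have ht1 : t ≤ 1 := div_le_one_of_le₀ (ha1.trans hsq1) (by positivity)
  -- Jordan's inequality, with `2 / π ≥ 1 / 2`
  have hsin : t / 2 ≤ Real.sin t := by
    refine le_trans ?_ (Real.mul_le_sin ht0.le (by linarith [Real.pi_gt_three]))
    have : 1 / 2 ≤ 2 / Real.pi := by
      rw [div_le_div_iff₀ two_pos Real.pi_pos]; linarith [Real.pi_le_four]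
    nlinarith
  have hnorm : ∀ i : Bool, ‖if i then t • e else -(t • e)‖ = t := by
    intro i
    cases i <;> simp [norm_smul, he, abs_of_pos ht0]
  refine le_trans (ENNReal.ofReal_le_ofReal ?_) (le_minimaxRisk hV hV1 hVM
    (fun i : Bool => if i then t • e else -(t • e))
    (fun i => (hnorm i).trans_le ht1) (fun i => ?_)
    (show 0 < Real.sin t / 2 by linarith)
    fun σ hσ => exists_holderNorm_le_one_of_antipodal hs he t hσ)
  · have : a / 32 * (1 / √(n : ℝ)) = t / 32 := by rw [ht]; ring
    linarith
  · rw [hnorm]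
    refine (hexp n 1 t (le_of_eq ?_)).trans (by norm_num)
    rw [ht, div_pow, Real.sq_sqrt hn0.le]
    field_simp
    simp

/-- The dimension-dependent rate `(√(d / n) ∧ 1) ^ s`, from `2 ^ d` separated points in a ball
of radius of order `√(d / n) ∧ 1`. -/
theorem exists_dimensional_le_minimaxRisk {M : ℝ} (hM : 0 < M) {s : ℝ} (hs : 0 < s) :
    ∃ c : ℝ, 0 < c ∧ ∀ (n d : ℕ), 1 ≤ n → 1 ≤ d → ∀ V : Euc d → ℝ,
      ContDiff ℝ 2 V → ∫⁻ x : Euc d, ENNReal.ofReal (Real.exp (-V x)) = 1 →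
      (∀ x, ‖iteratedFDeriv ℝ 2 V x‖ ≤ M) →
        ENNReal.ofReal (c * min √((d : ℝ) / n) 1 ^ s) ≤ minimaxRisk V n s := by
  obtain ⟨a, ha, ha1, hexp⟩ := exists_radius hM
  obtain ⟨A, hA1, hA⟩ := exists_norm_iteratedFDeriv_bump_le (holderOrder s + 1)
  have hA0 : 0 < A := by linarith
  refine ⟨(a / 8) ^ s / (16 * A), by positivity, fun n d hn hd V hV hV1 hVM => ?_⟩
  have hn0 : (0 : ℝ) < n := by exact_mod_cast hn
  have hd0 : (0 : ℝ) < d := by exact_mod_cast hd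
  set ε : ℝ := min √((d : ℝ) / n) 1
  have hε : 0 < ε := lt_min (Real.sqrt_pos.2 (by positivity)) one_pos
  have hε1 : ε ≤ 1 := min_le_right _ _
  have hnε : n * ε ^ 2 ≤ d := by
    have : ε ^ 2 ≤ d / n := by
      rw [← Real.sq_sqrt (show 0 ≤ (d : ℝ) / n by positivity)]
      gcongr
      exact min_le_left _ _
    rwa [le_div_iff₀ hn0, mul_comm] at this
  obtain ⟨t, htc, ht1, ht2⟩ := exists_separated_finset_card_eq (d := d) (2 ^ d) le_rfl
  have : Nonempty t := (Finset.card_pos.1 (by rw [htc]; positivity)).to_subtype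
  have haε : a * ε ≤ 1 := mul_le_one₀ ha1 hε.le hε1
  have hnorm : ∀ u : Euc d, ‖(a * ε) • u‖ = a * ε * ‖u‖ := fun u => by
    rw [norm_smul, Real.norm_of_nonneg (by positivity)]
  refine le_trans (ENNReal.ofReal_le_ofReal (le_of_eq ?_)) (le_minimaxRisk hV hV1
    hVM (fun u : t => (a * ε) • (u : Euc d)) (fun u => ?_) (fun u => ?_)
    (show 0 < (a * ε / 8) ^ s / (2 * A) by positivity)
    fun σ hσ => exists_holderNorm_le_one_of_separated hs hA0 (hA d) (by positivity)
      (by linarith) (fun u v huv => ?_) hσ)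
  · rw [show a * ε / 8 = a / 8 * ε by ring, Real.mul_rpow (by positivity) hε.le]
    ring
  · rw [hnorm]
    exact mul_le_one₀ haε (norm_nonneg _) (ht1 u u.2)
  · refine (hexp n d _ ?_).trans ?_
    · have hu : ‖(u : Euc d)‖ ^ 2 ≤ 1 := pow_le_one₀ (norm_nonneg _) (ht1 u u.2)
      calc n * ‖(a * ε) • (u : Euc d)‖ ^ 2 = n * ε ^ 2 * a ^ 2 * ‖(u : Euc d)‖ ^ 2 := by
            rw [hnorm]; ring
        _ ≤ d * a ^ 2 * 1 := by gcongr
        _ = d * a ^ 2 := mul_one _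
    · obtain ⟨k, rfl⟩ := Nat.exists_eq_add_of_le' hd
      have : (3 / 2 : ℝ) ^ k ≤ 2 ^ k := by gcongr; norm_num
      rw [Fintype.card_coe, htc]
      push_cast
      rw [pow_succ, pow_succ]
      linarith
  · have h := ht2 u u.2 v v.2 (fun h => huv (Subtype.ext h))
    rw [← smul_sub, hnorm]
    have : 0 < a * ε := by positivity
    nlinarith

end LogConcave

end

theorem mainTheorem4 (s : ℝ) (hs : 0 < s) (m M : ℝ) (hm : 0 < m) (hM : 0 < M) :
    ∃ c : ℝ, 0 < c ∧
      ∀ (L : ℝ), 0 < L → ∀ (n d : ℕ), 1 ≤ n → 1 ≤ d →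
        ∀ V : LogConcave.Euc d → ℝ, LogConcave.MainAssumption V m M L →
          ENNReal.ofReal
              (c * min (max (1 / Real.sqrt (n : ℝ)) (Real.sqrt ((d : ℝ) / (n : ℝ)) ^ s)) 1) ≤
            LogConcave.minimaxRisk V n s := by
  obtain ⟨c₁, hc₁, h₁⟩ := LogConcave.exists_parametric_le_minimaxRisk hM
  obtain ⟨c₂, hc₂, h₂⟩ := LogConcave.exists_dimensional_le_minimaxRisk hM hs
  refine ⟨min c₁ c₂, lt_min hc₁ hc₂, fun L _ n d hn hd V hV => ?_⟩
  have hpar := h₁ s hs n d hn hd V hV.contDiff hV.isDensity hV.hessian_bound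
  have hdim := h₂ n d hn hd V hV.contDiff hV.isDensity hV.hessian_bound
  -- capping the scale `√(d / n)` at `1` absorbs the outer minimum with `1`
  have hmax : min (max (1 / √(n : ℝ)) (√((d : ℝ) / n) ^ s)) 1 ≤
      max (1 / √(n : ℝ)) (min √((d : ℝ) / n) 1 ^ s) := by
    rcases le_total √((d : ℝ) / n) 1 with h | h
    · rw [min_eq_left h]
      exact min_le_left _ _
    · rw [min_eq_right h, Real.one_rpow]
      exact (min_le_right _ _).trans (le_max_right _ _)
  refine (ENNReal.ofReal_le_ofReal (mul_le_mul_of_nonneg_left hmax (by positivity))).trans ?_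
  rcases max_choice (1 / √(n : ℝ)) (min √((d : ℝ) / n) 1 ^ s) with h | h <;> rw [h]
  · refine le_trans (ENNReal.ofReal_le_ofReal ?_) hpar
    gcongr
    exact min_le_left _ _
  · refine le_trans (ENNReal.ofReal_le_ofReal ?_) hdim
    gcongr
    exact min_le_right _ _
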